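/- **Setting.** Let $\mathbb C$ be a lextensive category (finite limits, finite coproducts, and extensive). For a class $\mathcal Z$ of objects, a morphism is *$\mathcal Z$-trivial* if it factors through an object of $\mathcal Z$. A morphism $k\colon K\to X$ is a *$\mathcal Z$-kernel* of $f\colon X\to Y$ if $fk$ is $\mathcal Z$-trivial and every $\lambda$ with $f\lambda$ $\mathcal Z$-trivial factors uniquely through $k$; *$\mathcal Z$-cokernels* are defined dually. A sequence $A\xrightarrow{f}B\xrightarrow{g}C$ is *short $\mathcal Z$-exact* if $f$ is a $\mathcal Z$-kernel of $g$ and $g$ is a $\mathcal Z$-cokernel of $f$. A *pretorsion theory* $(\mathcal T,\mathcal F)$ in $\mathbb C$ is a pair of replete full subcategories such that, with $\mathcal Z:=\mathcal T\cap\mathcal F$, every morphism from an object of $\mathcal T$ to an object of $\mathcal F$ is $\mathcal Z$-trivial, and every object $X$ admits a short $\mathcal Z$-exact sequence $T(X)\to X\to F(X)$ with $T(X)\in\mathcal T$, $F(X)\in\mathcal F$. A *complemented subobject* of $X$ is a coprojection $A\rightarrowtail X$ of a decomposition $X=A+A'$. **The stable category.** $\mathsf{Par}(\mathbb C)$ has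 the objects of $\mathbb C$; a morphism $X\to Y$ is a pair $(\alpha,f)$ of a complemented subobject $\alpha\colon A\rightarrowtail X$ and a morphism $f\colon A\to Y$, up to isomorphism of $A$, composed by pullback. Put $(\alpha_1,f_1)\sim(\alpha_2,f_2)$ (parallel morphisms with domains of definition $A_1,A_2$) if there are decompositions $A_1=C+C_1^c$ and $A_2=C+C_2^c$ such that the two composites $C\rightarrowtail A_i\rightarrowtail X$ agree, $f_1$ and $f_2$ agree on $C$, and $f_1|_{C_1^c}$, $f_2|_{C_2^c}$ are $\mathcal Z$-trivial. Then $\mathsf{Stab}(\mathbb C)$ is the quotient of $\mathsf{Par}(\mathbb C)$ by $\sim$, and $\Sigma\colon\mathbb C\to\mathsf{Stab}(\mathbb C)$ is the identity on objects and sends $f$ to the class of $(1,f)$. **Theorem.** Let $(\mathcal T,\mathcal F)$ be a pretorsion theory in a lextensive category $\mathbb C$, let $\mathcal Z=\mathcal T\cap\mathcal F$ be closed under binary coproducts, and assume that $\mathcal T$ is closed under complemented subobjects. Then: 1. $\mathsf{Stab}(\mathbb C)$ is well defined, that is, $\sim$ is a congruence on $\mathsf{Par}(\mathbb C)$ (an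 equivalence relation on each hom-set, compatible with composition on both sides); moreover $\mathsf{Stab}(\mathbb C)$ is pointed. 2. $\Sigma$ sends $\mathcal Z$-kernels to kernels and short $\mathcal Z$-exact sequences to short exact sequences (the first morphism is a kernel of the second, the second a cokernel of the first). If all $\mathcal Z$-cokernels exist in $\mathbb C$, then $\Sigma$ sends $\mathcal Z$-cokernels to cokernels. 3. $(\mathcal T,\mathcal F)$ is a torsion theory in $\mathsf{Stab}(\mathbb C)$: both classes are closed under isomorphism in $\mathsf{Stab}(\mathbb C)$, every morphism there from an object of $\mathcal T$ to an object of $\mathcal F$ is zero, and every object $X$ admits a short exact sequence $0\to A\to X\to B\to 0$ with $A\in\mathcal T$ and $B\in\mathcal F$. Moreover $\Sigma$ is a torsion theory functor: it sends $\mathcal T$ into $\mathcal T$ and $\mathcal F$ into $\mathcal F$, and sends the canonical short $\mathcal Z$-exact sequence $T(X)\to X\to F(X)$ of each object $X$ of $\mathbb C$ to a short exact sequence. -/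

import Mathlib

universe v u v' u'

open CategoryTheory CategoryTheory.Limits

namespace PretorsionStab

/-! ### Pretorsion theories -/

section Pretorsion

variable {C : Type u} [Category.{v} C]

/-- A morphism is `Z`-trivial if it factors through an object of the class `Z`. -/
def IsTrivial (Z : ObjectProperty C) {X Y : C} (f : X ⟶ Y) : Prop :=
  ∃ (W : C) (p : X ⟶ W) (q : W ⟶ Y), Z W ∧ p ≫ q = f

/-- `k : K ⟶ X` is a `Z`-kernel of `f : X ⟶ Y`. -/
def IsZKernel (Z : ObjectProperty C) {K X Y : C} (k : K ⟶ X) (f : X ⟶ Y) : Prop :=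
  IsTrivial Z (k ≫ f) ∧
    ∀ {W : C} (l : W ⟶ X), IsTrivial Z (l ≫ f) → ∃! l' : W ⟶ K, l' ≫ k = l

/-- `q : Y ⟶ Q` is a `Z`-cokernel of `f : X ⟶ Y`. -/
def IsZCokernel (Z : ObjectProperty C) {X Y Q : C} (q : Y ⟶ Q) (f : X ⟶ Y) : Prop :=
  IsTrivial Z (f ≫ q) ∧
    ∀ {W : C} (l : Y ⟶ W), IsTrivial Z (f ≫ l) → ∃! l' : Q ⟶ W, q ≫ l' = l

/-- The sequence `A ⟶ X ⟶ B` is a short `Z`-exact sequence. -/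
def IsShortZExact (Z : ObjectProperty C) {A X B : C} (f : A ⟶ X) (g : X ⟶ B) : Prop :=
  IsZKernel Z f g ∧ IsZCokernel Z g f

/-- `C` has all `Z`-cokernels. -/
def HasZCokernels (Z : ObjectProperty C) : Prop :=
  ∀ {X Y : C} (f : X ⟶ Y), ∃ (Q : C) (q : Y ⟶ Q), IsZCokernel Z q f

/-- `(T, F)` is a pretorsion theory in `C`; the class of trivial objects is `T ⊓ F`. -/
structure IsPretorsionTheory (T F : ObjectProperty C) : Prop where
  torsion_replete : T.IsClosedUnderIsomorphisms
  torsionFree_replete : F.IsClosedUnderIsomorphisms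
  isTrivial_of_torsion_of_torsionFree :
    ∀ {X Y : C} (f : X ⟶ Y), T X → F Y → IsTrivial (T ⊓ F) f
  exists_shortZExact : ∀ X : C, ∃ (A B : C) (f : A ⟶ X) (g : X ⟶ B),
    T A ∧ F B ∧ IsShortZExact (T ⊓ F) f g

/-- `α : A ⟶ X` is a complemented subobject, i.e. a coprojection of a binary coproduct
decomposition `X = A + A'`. (In an extensive category such an `α` is automatically monic.) -/
def IsComplemented {A X : C} (α : A ⟶ X) : Prop :=
  ∃ (A' : C) (α' : A' ⟶ X), Nonempty (IsColimit (BinaryCofan.mk α α'))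

/-- The class `P` of objects is closed under complemented subobjects. -/
def ClosedUnderComplementedSubobjects (P : ObjectProperty C) : Prop :=
  ∀ {A X : C} (α : A ⟶ X), IsComplemented α → P X → P A

/-- The class `P` of objects is closed under binary coproducts. -/
def ClosedUnderBinaryCoproducts (P : ObjectProperty C) : Prop :=
  ∀ {A B X : C} (a : A ⟶ X) (b : B ⟶ X), Nonempty (IsColimit (BinaryCofan.mk a b)) →
    P A → P B → P X

end Pretorsion

/-! ### Torsion theories in pointed categories -/

section Torsion

variable {B : Type u} [Category.{v} B] [HasZeroMorphisms B]

/-- `k` is a kernel of `f`. -/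
def IsKernelOf {K X Y : B} (k : K ⟶ X) (f : X ⟶ Y) : Prop :=
  ∃ w : k ≫ f = 0, Nonempty (IsLimit (KernelFork.ofι k w))

/-- `q` is a cokernel of `f`. -/
def IsCokernelOf {X Y Q : B} (q : Y ⟶ Q) (f : X ⟶ Y) : Prop :=
  ∃ w : f ≫ q = 0, Nonempty (IsColimit (CokernelCofork.ofπ q w))

/-- `0 ⟶ A ⟶ X ⟶ Y ⟶ 0` is a short exact sequence: `f` is a kernel of `g` and `g` is a cokernel
of `f`. -/
def IsShortExactSeq {A X Y : B} (f : A ⟶ X) (g : X ⟶ Y) : Prop :=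
  IsKernelOf f g ∧ IsCokernelOf g f

/-- `(T, F)` is a torsion theory in the pointed category `B`. -/
structure IsTorsionTheory (T F : ObjectProperty B) : Prop where
  hasZeroObject : HasZeroObject B
  torsion_replete : T.IsClosedUnderIsomorphisms
  torsionFree_replete : F.IsClosedUnderIsomorphisms
  eq_zero : ∀ {X Y : B} (f : X ⟶ Y), T X → F Y → f = 0
  exists_shortExact : ∀ X : B, ∃ (A Y : B) (f : A ⟶ X) (g : X ⟶ Y),
    T A ∧ F Y ∧ IsShortExactSeq f g

/-- `G` is a torsion theory functor from the category `A` with the pretorsion theory `(T, F)` to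
the pointed category `B` with the torsion theory `(T', F')`. The canonical short exact sequence of
an object `X` is determined up to isomorphism, so all its choices are considered. -/
structure IsTorsionTheoryFunctor {A : Type u'} [Category.{v'} A] (T F : ObjectProperty A)
    (T' F' : ObjectProperty B) (G : A ⥤ B) : Prop where
  map_torsion : ∀ X : A, T X → T' (G.obj X)
  map_torsionFree : ∀ X : A, F X → F' (G.obj X)
  map_shortExact : ∀ {K X Q : A} (f : K ⟶ X) (g : X ⟶ Q), T K → F Q →
    IsShortZExact (T ⊓ F) f g → IsShortExactSeq (G.map f) (G.map g)

end Torsion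

/-! ### Partial morphisms -/

section Partial

variable {C : Type u} [Category.{v} C]

/-- A pair `(α, f)` with `α : A ⟶ X` a complemented subobject and `f : A ⟶ Y`. -/
structure PartialMap (X Y : C) where
  /-- the domain of definition -/
  dom : C
  /-- the inclusion of the domain of definition -/
  ι : dom ⟶ X
  isComplemented : IsComplemented ι
  /-- the underlying morphism -/
  map : dom ⟶ Y

/-- Two pairs are identified if they differ by an isomorphism of their domains. -/
def PartialMap.setoid (X Y : C) : Setoid (PartialMap X Y) where
  r f g := ∃ e : f.dom ≅ g.dom, e.hom ≫ g.ι = f.ι ∧ e.hom ≫ g.map = f.map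
  iseqv :=
    { refl := fun f => ⟨Iso.refl _, by simp, by simp⟩
      symm := by
        rintro f g ⟨e, h₁, h₂⟩
        exact ⟨e.symm, by simp [← h₁], by simp [← h₂]⟩
      trans := by
        rintro f g h ⟨e, h₁, h₂⟩ ⟨e', h₁', h₂'⟩
        exact ⟨e.trans e', by simp [h₁', h₁], by simp [h₂', h₂]⟩ }

/-- The category `Par C` of partial morphisms has the same objects as `C`. -/
structure Par (C : Type u) : Type u where
  /-- The underlying object of `C`. -/
  as : C

/-- Morphisms of `Par C` are equivalence classes of pairs. -/
def Par.Hom (X Y : Par C) : Type (max u v) := _root_.Quotient (PartialMap.setoid X.as Y.as)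

/-- The class of a pair. -/
def Par.Hom.mk {X Y : Par C} (f : PartialMap X.as Y.as) : Par.Hom X Y :=
  _root_.Quotient.mk (PartialMap.setoid X.as Y.as) f

theorem nonempty_isColimit_iff {A B X : C} (a : A ⟶ X) (b : B ⟶ X) :
    Nonempty (IsColimit (BinaryCofan.mk a b)) ↔
      ∀ {W : C} (f : A ⟶ W) (g : B ⟶ W), ∃! h : X ⟶ W, a ≫ h = f ∧ b ≫ h = g := by
  constructor
  · rintro ⟨hX⟩ W f g
    obtain ⟨l, h₁, h₂⟩ := BinaryCofan.IsColimit.desc' hX f g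
    exact ⟨l, ⟨h₁, h₂⟩, fun m hm => BinaryCofan.IsColimit.hom_ext hX (hm.1.trans h₁.symm)
      (hm.2.trans h₂.symm)⟩
  · intro H
    choose d hd hu using fun (W : C) (f : A ⟶ W) (g : B ⟶ W) => H f g
    exact ⟨BinaryCofan.isColimitMk (fun s => d s.pt s.inl s.inr) (fun s => (hd _ _ _).1)
      (fun s => (hd _ _ _).2) (fun s m h₁ h₂ => hu _ _ _ m ⟨h₁, h₂⟩)⟩

theorem isComplemented_of_isIso [HasInitial C] {A X : C} (α : A ⟶ X) [IsIso α] :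
    IsComplemented α := by
  refine ⟨⊥_ C, initial.to X, (nonempty_isColimit_iff _ _).2 fun f g => ⟨inv α ≫ f, ?_, ?_⟩⟩
  · exact ⟨by simp, initial.hom_ext _ _⟩
  · rintro m ⟨h, -⟩
    simp [← h]

theorem IsComplemented.comp [HasBinaryCoproducts C] {A B X : C} {β : B ⟶ A} {α : A ⟶ X}
    (hβ : IsComplemented β) (hα : IsComplemented α) : IsComplemented (β ≫ α) := by
  obtain ⟨B', β', hB⟩ := hβ
  obtain ⟨A', α', hA⟩ := hα
  rw [nonempty_isColimit_iff] at hA hB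
  refine ⟨B' ⨿ A', coprod.desc (β' ≫ α) α', (nonempty_isColimit_iff _ _).2 fun {W} f g => ?_⟩
  obtain ⟨l, ⟨hl₁, hl₂⟩, hl⟩ := hB f (coprod.inl ≫ g)
  obtain ⟨m, ⟨hm₁, hm₂⟩, hm⟩ := hA l (coprod.inr ≫ g)
  refine ⟨m, ⟨by rw [Category.assoc, hm₁, hl₁], ?_⟩, ?_⟩
  · apply coprod.hom_ext
    · rw [coprod.inl_desc_assoc, Category.assoc, hm₁, hl₂]
    · rw [coprod.inr_desc_assoc, hm₂]
  · rintro n ⟨hn₁, rfl⟩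
    refine hm n ⟨hl _ ⟨by rw [← hn₁, Category.assoc], ?_⟩, ?_⟩
    · rw [coprod.inl_desc_assoc, Category.assoc]
    · rw [coprod.inr_desc_assoc]

variable [FinitaryExtensive C]

theorem IsComplemented.mono {A X : C} {α : A ⟶ X} (h : IsComplemented α) : Mono α := by
  obtain ⟨A', α', ⟨hA⟩⟩ := h
  exact FinitaryExtensive.mono_inl_of_isColimit hA

variable [HasFiniteLimits C]

theorem IsComplemented.of_isPullback {P A B X : C} {p : P ⟶ A} {q : P ⟶ B} {f : A ⟶ X}
    {β : B ⟶ X} (h : IsPullback p q f β) (hβ : IsComplemented β) : IsComplemented p := by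
  obtain ⟨B', β', ⟨hB⟩⟩ := hβ
  refine ⟨pullback f β', pullback.fst f β', ?_⟩
  exact ((BinaryCofan.isVanKampen_iff _).1 (FinitaryExtensive.vanKampen _ hB)
    (BinaryCofan.mk p (pullback.fst f β')) q (pullback.snd f β') f h.w.symm
    pullback.condition.symm).2 ⟨h, IsPullback.of_hasPullback f β'⟩

/-- The composite `(β, g) ∘ (α, f) = (α α', g f')`, where `α'` and `f'` are the projections of the
pullback of `f` and `β`. -/
noncomputable abbrev PartialMap.comp {X Y Z : C} (f : PartialMap X Y) (g : PartialMap Y Z) :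
    PartialMap X Z where
  dom := pullback f.map g.ι
  ι := pullback.fst f.map g.ι ≫ f.ι
  isComplemented := ((g.isComplemented.of_isPullback
    (IsPullback.of_hasPullback f.map g.ι))).comp f.isComplemented
  map := pullback.snd f.map g.ι ≫ g.map

/-- A total morphism, viewed as a partial one. -/
abbrev PartialMap.ofHom {X Y : C} (f : X ⟶ Y) : PartialMap X Y where
  dom := X
  ι := 𝟙 X
  isComplemented := isComplemented_of_isIso _
  map := f

theorem PartialMap.comp_equiv {X Y Z : C} (f : PartialMap X Y) (g : PartialMap Y Z)
    (h : PartialMap X Z) (p : h.dom ⟶ f.dom) (q : h.dom ⟶ g.dom)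
    (sq : IsPullback p q f.map g.ι) (hι : p ≫ f.ι = h.ι) (hm : q ≫ g.map = h.map) :
    (PartialMap.setoid X Z).r (f.comp g) h := by
  refine ⟨(IsPullback.of_hasPullback f.map g.ι).isoIsPullback _ _ sq, ?_, ?_⟩
  · rw [← hι, ← Category.assoc, IsPullback.isoIsPullback_hom_fst]
  · rw [← hm, ← Category.assoc, IsPullback.isoIsPullback_hom_snd]

/-- Composition in `Par C`. -/
noncomputable def Par.Hom.comp {X Y Z : Par C} (f : Par.Hom X Y) (g : Par.Hom Y Z) :
    Par.Hom X Z :=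
  _root_.Quotient.map₂ (sa := PartialMap.setoid X.as Y.as) (sb := PartialMap.setoid Y.as Z.as)
    (sc := PartialMap.setoid X.as Z.as) PartialMap.comp (by
      rintro f₁ f₂ ⟨e, he₁, he₂⟩ g₁ g₂ ⟨e', he₁', he₂'⟩
      refine PartialMap.comp_equiv f₁ g₁ (f₂.comp g₂) (pullback.fst f₂.map g₂.ι ≫ e.inv)
        (pullback.snd f₂.map g₂.ι ≫ e'.inv) ?_ ?_ ?_
      · refine IsPullback.of_iso (IsPullback.of_hasPullback f₂.map g₂.ι) (Iso.refl _) e.symm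
          e'.symm (Iso.refl _) ?_ ?_ ?_ ?_ <;> simp [PartialMap.comp, ← he₁', ← he₂]
      · simp [PartialMap.comp, ← he₁]
      · simp [PartialMap.comp, ← he₂']) f g

theorem Par.Hom.mk_comp_mk {X Y Z : Par C} (f : PartialMap X.as Y.as) (g : PartialMap Y.as Z.as)
    (h : PartialMap X.as Z.as) (p : h.dom ⟶ f.dom) (q : h.dom ⟶ g.dom)
    (sq : IsPullback p q f.map g.ι) (hι : p ≫ f.ι = h.ι) (hm : q ≫ g.map = h.map) :
    Par.Hom.comp (Par.Hom.mk f) (Par.Hom.mk g) = Par.Hom.mk h :=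
  _root_.Quotient.sound (s := PartialMap.setoid X.as Z.as)
    (PartialMap.comp_equiv f g h p q sq hι hm)

noncomputable instance : Category.{max u v} (Par C) where
  Hom X Y := Par.Hom X Y
  id X := Par.Hom.mk (PartialMap.ofHom (𝟙 X.as))
  comp f g := Par.Hom.comp f g
  id_comp := by
    rintro X Y ⟨f⟩
    exact Par.Hom.mk_comp_mk (PartialMap.ofHom (𝟙 X.as)) f f f.ι (𝟙 _)
      (IsPullback.of_vert_isIso ⟨by simp [PartialMap.ofHom]⟩) (by simp [PartialMap.ofHom])
      (by simp)
  comp_id := by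
    rintro X Y ⟨f⟩
    exact Par.Hom.mk_comp_mk f (PartialMap.ofHom (𝟙 Y.as)) f (𝟙 _) f.map
      (IsPullback.of_horiz_isIso ⟨by simp [PartialMap.ofHom]⟩) (by simp)
      (by simp [PartialMap.ofHom])
  assoc := by
    rintro X Y Z W ⟨f⟩ ⟨g⟩ ⟨h⟩
    have sq := IsPullback.of_hasPullback (pullback.snd f.map g.ι) (pullback.fst g.map h.ι)
    have sq₁ := IsPullback.of_hasPullback f.map g.ι
    have sq₂ := IsPullback.of_hasPullback g.map h.ι
    let k : PartialMap X.as W.as :=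
      { dom := pullback (pullback.snd f.map g.ι) (pullback.fst g.map h.ι)
        ι := pullback.fst (pullback.snd f.map g.ι) (pullback.fst g.map h.ι) ≫
          pullback.fst f.map g.ι ≫ f.ι
        isComplemented := ((h.isComplemented.of_isPullback sq₂).of_isPullback sq).comp
          ((g.isComplemented.of_isPullback sq₁).comp f.isComplemented)
        map := pullback.snd (pullback.snd f.map g.ι) (pullback.fst g.map h.ι) ≫
          pullback.snd g.map h.ι ≫ h.map }
    refine (Par.Hom.mk_comp_mk (f.comp g) h k
      (pullback.fst (pullback.snd f.map g.ι) (pullback.fst g.map h.ι))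
      (pullback.snd (pullback.snd f.map g.ι) (pullback.fst g.map h.ι) ≫ pullback.snd g.map h.ι)
      (sq.paste_vert sq₂) rfl (by simp [k])).trans
      (Par.Hom.mk_comp_mk f (g.comp h) k
      (pullback.fst (pullback.snd f.map g.ι) (pullback.fst g.map h.ι) ≫ pullback.fst f.map g.ι)
      (pullback.snd (pullback.snd f.map g.ι) (pullback.fst g.map h.ι))
      (sq.flip.paste_vert sq₁.flip).flip (by simp [k]) rfl).symm

/-- The morphism of `Par C` represented by a pair. -/
def Par.homMk {X Y : Par C} (f : PartialMap X.as Y.as) : X ⟶ Y := Par.Hom.mk f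

variable (C) in
/-- The functor `I : C ⥤ Par C`, the identity on objects, sending `f` to the class of `(1, f)`. -/
noncomputable def inclusion : C ⥤ Par C where
  obj X := ⟨X⟩
  map f := Par.homMk (X := ⟨_⟩) (Y := ⟨_⟩) (PartialMap.ofHom f)
  map_id _ := rfl
  map_comp {X Y Z} f g := by
    refine (Par.Hom.mk_comp_mk (X := ⟨X⟩) (Y := ⟨Y⟩) (Z := ⟨Z⟩) (PartialMap.ofHom f)
      (PartialMap.ofHom g) (PartialMap.ofHom (f ≫ g)) (𝟙 X) f
      (IsPullback.of_horiz_isIso ⟨?_⟩) ?_ rfl).symm <;> simp [PartialMap.ofHom]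

/-! ### The stable category -/

/-- There is a congruence diagram (relative to the class `Z` of trivial objects) between the
parallel pairs `(α₁, f₁)` and `(α₂, f₂)`: decompositions `A₁ = D + D₁` and `A₂ = D + D₂` such that
`D` is the same subobject of `X`, the morphisms `f₁` and `f₂` agree on `D`, and they are trivial
on `D₁` and on `D₂` respectively. -/
def HasCongruenceDiagram (Z : ObjectProperty C) {X Y : C} (f₁ f₂ : PartialMap X Y) : Prop :=
  ∃ (D D₁ D₂ : C) (γ₁ : D ⟶ f₁.dom) (δ₁ : D₁ ⟶ f₁.dom) (γ₂ : D ⟶ f₂.dom) (δ₂ : D₂ ⟶ f₂.dom),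
    Nonempty (IsColimit (BinaryCofan.mk γ₁ δ₁)) ∧
    Nonempty (IsColimit (BinaryCofan.mk γ₂ δ₂)) ∧
    γ₁ ≫ f₁.ι = γ₂ ≫ f₂.ι ∧
    γ₁ ≫ f₁.map = γ₂ ≫ f₂.map ∧
    IsTrivial Z (δ₁ ≫ f₁.map) ∧
    IsTrivial Z (δ₂ ≫ f₂.map)

/-- The relation `∼` on the parallel morphisms of `Par C`. -/
def stableRel (Z : ObjectProperty C) : HomRel (Par C) := fun X Y φ ψ =>
  ∃ f₁ f₂ : PartialMap X.as Y.as,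
    Par.homMk f₁ = φ ∧ Par.homMk f₂ = ψ ∧ HasCongruenceDiagram Z f₁ f₂

/-- The stable category: the quotient of `Par C` by `∼`. (Mathlib's quotient is by the congruence
generated by a relation, that is, by `∼` itself whenever `∼` is a congruence.) -/
abbrev Stab (Z : ObjectProperty C) := CategoryTheory.Quotient (stableRel Z)

/-- The functor `Σ : C ⥤ Stab C`. -/
noncomputable def toStab (Z : ObjectProperty C) : C ⥤ Stab Z :=
  inclusion C ⋙ CategoryTheory.Quotient.functor (stableRel Z)

/-- A class of objects of `C`, viewed as a class of objects of the stable category (the stable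
category has the same objects as `C`). -/
def onStab (Z P : ObjectProperty C) : ObjectProperty (Stab Z) := fun X => P X.as.as

end Partial

end PretorsionStab

/-!
Let `Z = T ⊓ F`. The stable category depends on `Z` only through three closure properties: `Z`
contains the initial object and is closed under complemented subobjects and under binary
coproducts (`IsStableClass`). The last is a hypothesis. For the others, the reflection of the
initial object into `F` is an epimorphism out of it, hence initial by disjointness, and `F` is
closed under complemented subobjects because the inclusion of a complemented `A` in a torsion-free
`X` extends to the reflection of `A`, and the inverse image of `A` is all of that reflection
(`IsPretorsionTheory.isStableClass`).

Under these properties, triviality of a morphism can be tested on the two parts of a decomposition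
of its source, and after composition with a complemented monomorphism. As decompositions are
stable under pullback, congruence diagrams can be composed and can be pulled back along partial
maps, so that `∼` is a congruence (`IsStableClass.congruence`). A partial map is zero in the
stable category if and only if its underlying morphism is trivial
(`IsStableClass.stabMk_eq_zero_iff`).

A `Z`-kernel is monic and reflects triviality, from which it follows at once that it becomes a
kernel. For a `Z`-cokernel `q : X ⟶ Q` of `f : A ⟶ X`, the key fact is that decompositions of `X`
descend to `Q` (`IsZCokernel.exists_isDecomposition`): if morphisms `D ⟶ W` and `D' ⟶ W'` on the
parts of `X = D + D'` are trivial on the parts of `A`, then so is `X ⟶ W + W'` on `A`, which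
therefore extends to `Q ⟶ W + W'`, and pulling back the coprojections decomposes `Q`. With
`q` itself on one of the parts this extends partial maps along `q`; with `q` on both parts it makes
congruence diagrams descend, once `Z`-cokernels are known to restrict to complemented subobjects
(`IsZCokernel.of_isPullback`). So `Z`-cokernels always become cokernels
(`IsStableClass.isCokernelOf_map`).

The torsion objects are those with only trivial morphisms to torsion-free objects, and dually. As
`T` is closed under complemented subobjects, this orthogonality persists for partial maps, and
becomes orthogonality with respect to zero morphisms in the stable category, which is invariant
under isomorphism there (`IsPretorsionTheory.isTorsionTheory_stab`).
-/

namespace PretorsionStab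

/-! ### Binary coproduct decompositions -/

section Decomposition

variable {C : Type u} [Category.{v} C]

/-- `X` is the coproduct of `A` and `B`, with coprojections `a` and `b`. -/
abbrev IsDecomposition {A B X : C} (a : A ⟶ X) (b : B ⟶ X) : Prop :=
  Nonempty (IsColimit (BinaryCofan.mk a b))

namespace IsDecomposition

variable {A B X : C} {a : A ⟶ X} {b : B ⟶ X}

theorem symm (h : IsDecomposition a b) : IsDecomposition b a := by
  refine (nonempty_isColimit_iff _ _).2 fun f g => ?_
  obtain ⟨l, ⟨h₁, h₂⟩, hu⟩ := (nonempty_isColimit_iff _ _).1 h g f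
  exact ⟨l, ⟨h₂, h₁⟩, fun m hm => hu m ⟨hm.2, hm.1⟩⟩

theorem desc (h : IsDecomposition a b) {W : C} (f : A ⟶ W) (g : B ⟶ W) :
    ∃ m : X ⟶ W, a ≫ m = f ∧ b ≫ m = g :=
  ((nonempty_isColimit_iff _ _).1 h f g).exists

theorem hom_ext (h : IsDecomposition a b) {W : C} {f g : X ⟶ W} (ha : a ≫ f = a ≫ g)
    (hb : b ≫ f = b ≫ g) : f = g :=
  ((nonempty_isColimit_iff _ _).1 h (a ≫ g) (b ≫ g)).unique ⟨ha, hb⟩ ⟨rfl, rfl⟩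

theorem isComplemented (h : IsDecomposition a b) : IsComplemented a := ⟨B, b, h⟩

theorem coprod [HasBinaryCoproducts C] (A B : C) :
    IsDecomposition (coprod.inl : A ⟶ A ⨿ B) coprod.inr :=
  ⟨coprodIsCoprod A B⟩

theorem id_initial [HasInitial C] (X : C) : IsDecomposition (𝟙 X) (initial.to X) :=
  (nonempty_isColimit_iff _ _).2 fun f g =>
    ⟨f, ⟨by simp, initial.hom_ext _ _⟩, fun m hm => by simpa using hm.1⟩

theorem initial_id [HasInitial C] (X : C) : IsDecomposition (initial.to X) (𝟙 X) :=
  (id_initial X).symm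

theorem comp_iso (h : IsDecomposition a b) {Y : C} (e : X ≅ Y) :
    IsDecomposition (a ≫ e.hom) (b ≫ e.hom) := by
  refine (nonempty_isColimit_iff _ _).2 fun f g => ?_
  obtain ⟨l, ⟨h₁, h₂⟩, hu⟩ := (nonempty_isColimit_iff _ _).1 h f g
  refine ⟨e.inv ≫ l, ⟨by simp [h₁], by simp [h₂]⟩, fun m hm => ?_⟩
  rw [← hu (e.hom ≫ m) ⟨by simp [← hm.1], by simp [← hm.2]⟩, Iso.inv_hom_id_assoc]

theorem iso_comp (h : IsDecomposition a b) {A' : C} (e : A' ≅ A) :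
    IsDecomposition (e.hom ≫ a) b := by
  refine (nonempty_isColimit_iff _ _).2 fun f g => ?_
  obtain ⟨l, ⟨h₁, h₂⟩, hu⟩ := (nonempty_isColimit_iff _ _).1 h (e.inv ≫ f) g
  exact ⟨l, ⟨by simp [h₁], h₂⟩, fun m hm => hu m ⟨by simp [← hm.1], hm.2⟩⟩

/-- If `X = A + B` and `A = D + E`, then `X = D + (E + B)`. -/
theorem comp [HasBinaryCoproducts C] (h : IsDecomposition a b) {D E : C} {d : D ⟶ A} {e : E ⟶ A}
    (h' : IsDecomposition d e) : IsDecomposition (d ≫ a) (coprod.desc (e ≫ a) b) := by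
  refine (nonempty_isColimit_iff _ _).2 fun {W} f g => ?_
  obtain ⟨l, hl₁, hl₂⟩ := h'.desc f (coprod.inl ≫ g)
  obtain ⟨m, hm₁, hm₂⟩ := h.desc l (coprod.inr ≫ g)
  have hm : coprod.desc (e ≫ a) b ≫ m = g :=
    coprod.hom_ext (by rw [coprod.inl_desc_assoc, Category.assoc, hm₁, hl₂])
      (by rw [coprod.inr_desc_assoc, hm₂])
  refine ⟨m, ⟨by rw [Category.assoc, hm₁, hl₁], hm⟩, ?_⟩
  rintro n ⟨hn₁, hn₂⟩
  refine h.hom_ext (h'.hom_ext ?_ ?_) ?_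
  · rw [hm₁, hl₁, ← hn₁, Category.assoc]
  · rw [hm₁, hl₂, ← hn₂, coprod.inl_desc_assoc, Category.assoc]
  · rw [hm₂, ← hn₂, coprod.inr_desc_assoc]

variable [FinitaryExtensive C]

theorem of_isPullback (h : IsDecomposition a b) {W P P' : C} {f : W ⟶ X} {p : P ⟶ W} {q : P ⟶ A}
    {p' : P' ⟶ W} {q' : P' ⟶ B} (ha : IsPullback p q f a) (hb : IsPullback p' q' f b) :
    IsDecomposition p p' := by
  obtain ⟨h⟩ := h
  exact ((BinaryCofan.isVanKampen_iff _).1 (FinitaryExtensive.vanKampen _ h)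
    (BinaryCofan.mk p p') q q' f ha.w.symm hb.w.symm).2 ⟨ha, hb⟩

theorem isPullback (h : IsDecomposition a b) {W P P' : C} {f : W ⟶ X} {p : P ⟶ W} {q : P ⟶ A}
    {p' : P' ⟶ W} {q' : P' ⟶ B} (h' : IsDecomposition p p') (ha : p ≫ f = q ≫ a)
    (hb : p' ≫ f = q' ≫ b) : IsPullback p q f a := by
  obtain ⟨h⟩ := h
  exact (((BinaryCofan.isVanKampen_iff _).1 (FinitaryExtensive.vanKampen _ h)
    (BinaryCofan.mk p p') q q' f ha.symm hb.symm).1 h').1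

theorem pullback [HasFiniteLimits C] (h : IsDecomposition a b) {W : C} (f : W ⟶ X) :
    IsDecomposition (pullback.fst f a) (pullback.fst f b) :=
  h.of_isPullback (IsPullback.of_hasPullback f a) (IsPullback.of_hasPullback f b)

theorem isPullback_initial (h : IsDecomposition a b) :
    IsPullback (initial.to A) (initial.to B) a b := by
  obtain ⟨h⟩ := h
  exact FinitaryExtensive.isPullback_initial_to_binaryCofan h

/-- A morphism into `A + B` that is disjoint from `A` factors through `B`. -/
theorem exists_lift_of_isDecomposition [HasFiniteLimits C] (h : IsDecomposition a b) {B' : C}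
    {b' : B' ⟶ X} (h' : IsDecomposition a b') : ∃ u : B' ⟶ B, u ≫ b = b' := by
  have hd := h.of_isPullback h'.isPullback_initial.flip (IsPullback.of_hasPullback b' b)
  obtain ⟨u, -, hu⟩ := hd.desc (initial.to B) (pullback.snd b' b)
  exact ⟨u, hd.hom_ext (initial.hom_ext _ _) (by rw [reassoc_of% hu, pullback.condition])⟩

end IsDecomposition

theorem isIso_initial_to [FinitaryExtensive C] {X : C} (x : X ⟶ ⊥_ C) : IsIso (initial.to X) := by
  have := initialIsInitial.isIso_to x
  rw [show initial.to X = inv x from initial.hom_ext _ _]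
  infer_instance

theorem isIso_initial_to_of_comp_inl_eq_comp_inr [FinitaryExtensive C]
    {X A B : C} {a : X ⟶ A} {b : X ⟶ B}
    (h : a ≫ (coprod.inl : A ⟶ A ⨿ B) = b ≫ coprod.inr) :
    IsIso (initial.to X) :=
  isIso_initial_to ((IsDecomposition.coprod A B).isPullback_initial.lift a b h)

end Decomposition

/-! ### Trivial morphisms -/

section Trivial

variable {C : Type u} [Category.{v} C] {Z : ObjectProperty C}

theorem IsTrivial.precomp {X Y W : C} {f : X ⟶ Y} (h : IsTrivial Z f) (g : W ⟶ X) :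
    IsTrivial Z (g ≫ f) := by
  obtain ⟨V, p, q, hV, rfl⟩ := h
  exact ⟨V, g ≫ p, q, hV, Category.assoc _ _ _⟩

theorem IsTrivial.postcomp {X Y W : C} {f : X ⟶ Y} (h : IsTrivial Z f) (g : Y ⟶ W) :
    IsTrivial Z (f ≫ g) := by
  obtain ⟨V, p, q, hV, rfl⟩ := h
  exact ⟨V, p, q ≫ g, hV, (Category.assoc _ _ _).symm⟩

theorem isTrivial_of_source {X Y : C} (hX : Z X) (f : X ⟶ Y) : IsTrivial Z f :=
  ⟨X, 𝟙 X, f, hX, Category.id_comp f⟩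

theorem isTrivial_of_target {X Y : C} (hY : Z Y) (f : X ⟶ Y) : IsTrivial Z f :=
  ⟨Y, f, 𝟙 Y, hY, Category.comp_id f⟩

/-- The closure properties of the class of trivial objects on which the stable category depends. -/
structure IsStableClass [HasInitial C] (Z : ObjectProperty C) : Prop where
  initial : Z (⊥_ C)
  coproducts : ClosedUnderBinaryCoproducts Z
  complemented : ClosedUnderComplementedSubobjects Z

theorem IsStableClass.of_iso [HasInitial C] (hZ : IsStableClass Z) {X Y : C} (e : X ≅ Y)
    (hX : Z X) : Z Y :=
  hZ.complemented e.inv (isComplemented_of_isIso _) hX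

variable [FinitaryExtensive C]

theorem IsStableClass.isTrivial_of_isDecomposition (hZ : IsStableClass Z) {A B X Y : C}
    {a : A ⟶ X} {b : B ⟶ X} (h : IsDecomposition a b) {f : X ⟶ Y} (ha : IsTrivial Z (a ≫ f))
    (hb : IsTrivial Z (b ≫ f)) : IsTrivial Z f := by
  obtain ⟨V, p, q, hV, hpq⟩ := ha
  obtain ⟨V', p', q', hV', hpq'⟩ := hb
  obtain ⟨m, hm, hm'⟩ := h.desc (p ≫ coprod.inl) (p' ≫ coprod.inr)
  refine ⟨V ⨿ V', m, coprod.desc q q', hZ.coproducts _ _ (IsDecomposition.coprod V V') hV hV',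
    h.hom_ext ?_ ?_⟩
  · rw [reassoc_of% hm, coprod.inl_desc, hpq]
  · rw [reassoc_of% hm', coprod.inr_desc, hpq']

theorem IsStableClass.isTrivial_of_isIso_initial_to (hZ : IsStableClass Z) {X Y : C}
    [IsIso (initial.to X)] (f : X ⟶ Y) : IsTrivial Z f :=
  isTrivial_of_source (hZ.of_iso (asIso (initial.to X)) hZ.initial) f

variable [HasFiniteLimits C]

/-- Triviality can be checked after composition with a complemented monomorphism: pull the
trivial object back along it. -/
theorem IsStableClass.isTrivial_of_comp (hZ : IsStableClass Z) {X Y W : C} {g : X ⟶ Y}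
    {β : Y ⟶ W} (hβ : IsComplemented β) (h : IsTrivial Z (g ≫ β)) : IsTrivial Z g := by
  obtain ⟨V, p, q, hV, hpq⟩ := h
  have := hβ.mono
  refine ⟨pullback q β, pullback.lift p g hpq, pullback.snd q β,
    hZ.complemented _ (hβ.of_isPullback (IsPullback.of_hasPullback q β)) hV,
    pullback.lift_snd _ _ _⟩

end Trivial

/-! ### Pretorsion theories in lextensive categories -/

section Pretorsion

variable {C : Type u} [Category.{v} C]

theorem IsZKernel.mono {Z : ObjectProperty C} {K X Y : C} {k : K ⟶ X} {f : X ⟶ Y}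
    (h : IsZKernel Z k f) : Mono k := by
  refine ⟨fun {W} u w huw => ?_⟩
  have : IsTrivial Z ((u ≫ k) ≫ f) := by rw [Category.assoc]; exact h.1.precomp u
  exact (h.2 _ this).unique rfl huw.symm

theorem IsZCokernel.epi {Z : ObjectProperty C} {X Y Q : C} {q : Y ⟶ Q} {f : X ⟶ Y}
    (h : IsZCokernel Z q f) : Epi q := by
  refine ⟨fun {W} u w huw => ?_⟩
  have : IsTrivial Z (f ≫ q ≫ u) := by rw [← Category.assoc]; exact h.1.postcomp u
  exact (h.2 _ this).unique rfl huw.symm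

/-- Triviality of a morphism into a `Z`-kernel can be checked after composition with it, because
morphisms from objects of `Z` lift through `k`. -/
theorem IsZKernel.isTrivial_of_comp {Z : ObjectProperty C} {K X Y W : C} {k : K ⟶ X} {f : X ⟶ Y}
    (h : IsZKernel Z k f) {g : W ⟶ K} (hg : IsTrivial Z (g ≫ k)) : IsTrivial Z g := by
  obtain ⟨V, p, q, hV, hpq⟩ := hg
  obtain ⟨s, hs, -⟩ := h.2 q (isTrivial_of_source hV _)
  have := h.mono
  exact ⟨V, p, s, hV, by rw [← cancel_mono k, Category.assoc, hs, hpq]⟩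

theorem IsZCokernel.isTrivial_of_comp {Z : ObjectProperty C} {X Y Q W : C} {q : Y ⟶ Q}
    {f : X ⟶ Y} (h : IsZCokernel Z q f) {g : Q ⟶ W} (hg : IsTrivial Z (q ≫ g)) :
    IsTrivial Z g := by
  obtain ⟨V, p, r, hV, hpr⟩ := hg
  obtain ⟨s, hs, -⟩ := h.2 p (isTrivial_of_target hV _)
  have := h.epi
  exact ⟨V, s, r, hV, by rw [← cancel_epi q, reassoc_of% hs, hpr]⟩

namespace IsPretorsionTheory

variable {T F : ObjectProperty C}

/-- The torsion objects are those with only trivial morphisms to torsion-free objects. -/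
theorem torsion_of_isTrivial (hTF : IsPretorsionTheory T F) {X : C}
    (h : ∀ {Y : C} (f : X ⟶ Y), F Y → IsTrivial (T ⊓ F) f) : T X := by
  obtain ⟨A, B, f, g, hA, hB, hk, -⟩ := hTF.exists_shortZExact X
  obtain ⟨s, hs, -⟩ := hk.2 (𝟙 X) (by simpa using h g hB)
  have := hk.mono
  have := hTF.torsion_replete
  exact T.prop_of_iso (Iso.mk f s (by rw [← cancel_mono f]; simp [hs]) hs) hA

/-- The torsion-free objects are those with only trivial morphisms from torsion objects. -/
theorem torsionFree_of_isTrivial (hTF : IsPretorsionTheory T F) {Y : C}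
    (h : ∀ {X : C} (f : X ⟶ Y), T X → IsTrivial (T ⊓ F) f) : F Y := by
  obtain ⟨A, B, f, g, hA, hB, -, hq⟩ := hTF.exists_shortZExact Y
  obtain ⟨r, hr, -⟩ := hq.2 (𝟙 Y) (by simpa using h f hA)
  have := hq.epi
  have := hTF.torsionFree_replete
  exact F.prop_of_iso (Iso.mk r g (by rw [← cancel_epi g, reassoc_of% hr]; simp) hr) hB

variable [FinitaryExtensive C]

theorem torsion_initial (hTF : IsPretorsionTheory T F) : T (⊥_ C) := by
  obtain ⟨A, B, f, g, hA, -⟩ := hTF.exists_shortZExact (⊥_ C)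
  have := initialIsInitial.isIso_to f
  have := hTF.torsion_replete
  exact T.prop_of_iso (asIso f) hA

/-- The reflection `g : ⊥_ C ⟶ B` of the initial object is an epimorphism, so the two
coprojections of `B + B` agree, and `B` is initial by disjointness. -/
theorem torsionFree_initial (hTF : IsPretorsionTheory T F) : F (⊥_ C) := by
  obtain ⟨A, B, f, g, -, hB, -, hq⟩ := hTF.exists_shortZExact (⊥_ C)
  have := hq.epi
  have := isIso_initial_to_of_comp_inl_eq_comp_inr (a := 𝟙 B) (b := 𝟙 B)
    (by rw [← cancel_epi g]; exact initial.hom_ext _ _)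
  have := hTF.torsionFree_replete
  exact F.prop_of_iso (asIso (initial.to B)).symm hB

variable [HasFiniteLimits C]

/-- If `A` is complemented in a torsion-free `X`, then the inclusion of `A` extends along the
reflection `g : A ⟶ B`. The preimage `B₁` of `A` in `B` retracts onto `A`, and its complement is
initial because `g` is an epimorphism that factors through `B₁`. -/
theorem torsionFree_complemented (hTF : IsPretorsionTheory T F) :
    ClosedUnderComplementedSubobjects F := by
  intro A X α hα hX
  have := hα.mono
  obtain ⟨A', α', hd : IsDecomposition α α'⟩ := hα
  obtain ⟨K, B, f, g, hK, hB, -, hq⟩ := hTF.exists_shortZExact A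
  have := hq.epi
  obtain ⟨r, hr, -⟩ := hq.2 α (hTF.isTrivial_of_torsion_of_torsionFree _ hK hX)
  have hd' := hd.pullback r
  let g₁ : A ⟶ pullback r α := pullback.lift g (𝟙 A) (by simp [hr])
  have hg₁ : g₁ ≫ pullback.fst r α = g := pullback.lift_fst _ _ _
  have hg₁' : g₁ ≫ pullback.snd r α = 𝟙 A := pullback.lift_snd _ _ _
  obtain ⟨m, hm, hm'⟩ := hd'.desc (pullback.fst r α ≫ (coprod.inl : B ⟶ B ⨿ B))
    (pullback.fst r α' ≫ coprod.inr)
  have hm₀ : m = coprod.inl := by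
    rw [← cancel_epi g, ← hg₁, Category.assoc, Category.assoc, hm]
  have := isIso_initial_to_of_comp_inl_eq_comp_inr (hm₀ ▸ hm')
  obtain ⟨s, hs, -⟩ := hd'.desc (pullback.snd r α)
    (inv (initial.to (pullback r α')) ≫ initial.to A)
  have hgs : g ≫ s = 𝟙 A := by rw [← hg₁, Category.assoc, hs, hg₁']
  have := hTF.torsionFree_replete
  exact F.prop_of_iso (Iso.mk s g (by rw [← cancel_epi g, reassoc_of% hgs]; simp) hgs) hB

theorem isStableClass (hTF : IsPretorsionTheory T F) (hZ : ClosedUnderBinaryCoproducts (T ⊓ F))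
    (hT : ClosedUnderComplementedSubobjects T) : IsStableClass (T ⊓ F) where
  initial := ⟨hTF.torsion_initial, hTF.torsionFree_initial⟩
  coproducts := hZ
  complemented α hα hX := ⟨hT α hα hX.1, hTF.torsionFree_complemented α hα hX.2⟩

end IsPretorsionTheory

end Pretorsion

/-! ### Congruence diagrams -/

section CongruenceDiagram

variable {C : Type u} [Category.{v} C] {Z : ObjectProperty C} {X Y : C}

theorem HasCongruenceDiagram.symm {f g : PartialMap X Y} (h : HasCongruenceDiagram Z f g) :
    HasCongruenceDiagram Z g f := by
  obtain ⟨D, D₁, D₂, γ₁, δ₁, γ₂, δ₂, h₁, h₂, hι, hm, ht₁, ht₂⟩ := h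
  exact ⟨D, D₂, D₁, γ₂, δ₂, γ₁, δ₁, h₂, h₁, hι.symm, hm.symm, ht₂, ht₁⟩

theorem HasCongruenceDiagram.of_equiv_left {f f' g : PartialMap X Y}
    (h : HasCongruenceDiagram Z f g) (e : (PartialMap.setoid X Y).r f f') :
    HasCongruenceDiagram Z f' g := by
  obtain ⟨D, D₁, D₂, γ₁, δ₁, γ₂, δ₂, h₁, h₂, hι, hm, ht₁, ht₂⟩ := h
  obtain ⟨e, he, he'⟩ := e
  exact ⟨D, D₁, D₂, γ₁ ≫ e.hom, δ₁ ≫ e.hom, γ₂, δ₂, IsDecomposition.comp_iso h₁ e, h₂,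
    by simpa [he] using hι, by simpa [he'] using hm, by simpa [he'] using ht₁, ht₂⟩

variable [FinitaryExtensive C]

theorem IsStableClass.hasCongruenceDiagram_refl (hZ : IsStableClass Z) (f : PartialMap X Y) :
    HasCongruenceDiagram Z f f :=
  ⟨f.dom, ⊥_ C, ⊥_ C, 𝟙 _, initial.to _, 𝟙 _, initial.to _, IsDecomposition.id_initial _,
    IsDecomposition.id_initial _, rfl, rfl, isTrivial_of_source hZ.initial _,
    isTrivial_of_source hZ.initial _⟩

theorem hasCongruenceDiagram_of_isTrivial {f g : PartialMap X Y}
    (hf : IsTrivial Z f.map) (hg : IsTrivial Z g.map) : HasCongruenceDiagram Z f g :=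
  ⟨⊥_ C, f.dom, g.dom, initial.to _, 𝟙 _, initial.to _, 𝟙 _, IsDecomposition.initial_id _,
    IsDecomposition.initial_id _, initial.hom_ext _ _, initial.hom_ext _ _,
    by simpa using hf, by simpa using hg⟩

theorem IsStableClass.isTrivial_of_hasCongruenceDiagram (hZ : IsStableClass Z)
    {f g : PartialMap X Y} (h : HasCongruenceDiagram Z f g) (hg : IsTrivial Z g.map) :
    IsTrivial Z f.map := by
  obtain ⟨D, D₁, D₂, γ₁, δ₁, γ₂, δ₂, h₁, h₂, hι, hm, ht₁, ht₂⟩ := h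
  exact hZ.isTrivial_of_isDecomposition h₁ (hm ▸ hg.precomp γ₂) ht₁

variable [HasFiniteLimits C]

theorem stableRel_homMk_iff {X Y : Par C} (f g : PartialMap X.as Y.as) :
    stableRel Z (Par.homMk f) (Par.homMk g) ↔ HasCongruenceDiagram Z f g := by
  constructor
  · rintro ⟨f', g', hf, hg, h⟩
    have hf := _root_.Quotient.exact (s := PartialMap.setoid X.as Y.as) hf
    have hg := _root_.Quotient.exact (s := PartialMap.setoid X.as Y.as) hg
    exact ((h.of_equiv_left hf).symm.of_equiv_left hg).symm
  · exact fun h => ⟨f, g, rfl, rfl, h⟩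

/-- Two congruence diagrams are composed by intersecting their common parts `D` and `E`. Off the
intersection, `D` lies in the part where the second diagram has trivial morphisms, and `E` in the
part where the first one has. -/
theorem IsStableClass.hasCongruenceDiagram_trans (hZ : IsStableClass Z) {f g h : PartialMap X Y}
    (hfg : HasCongruenceDiagram Z f g) (hgh : HasCongruenceDiagram Z g h) :
    HasCongruenceDiagram Z f h := by
  obtain ⟨D, D₁, D₂, γ₁, δ₁, γ₂, δ₂, hd₁ : IsDecomposition _ _, hd₂ : IsDecomposition _ _,
    hι, hm, ht₁, ht₂⟩ := hfg
  obtain ⟨E, E₂, E₃, ε₂, η₂, ε₃, η₃, he₂ : IsDecomposition _ _, he₃ : IsDecomposition _ _,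
    hι', hm', ht₂', ht₃⟩ := hgh
  have hD := he₂.pullback γ₂
  have hE := hd₂.of_isPullback (IsPullback.of_hasPullback γ₂ ε₂).flip
    (IsPullback.of_hasPullback ε₂ δ₂)
  refine ⟨_, _, _, _, _, _, _, hd₁.comp hD, he₃.comp hE, ?_, ?_, ?_, ?_⟩
  · rw [Category.assoc, Category.assoc, hι, ← hι', pullback.condition_assoc]
  · rw [Category.assoc, Category.assoc, hm, ← hm', pullback.condition_assoc]
  · refine hZ.isTrivial_of_isDecomposition (IsDecomposition.coprod _ _) ?_ ?_
    · rw [coprod.inl_desc_assoc, Category.assoc, hm, pullback.condition_assoc]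
      exact ht₂'.precomp _
    · rwa [coprod.inr_desc_assoc]
  · refine hZ.isTrivial_of_isDecomposition (IsDecomposition.coprod _ _) ?_ ?_
    · rw [coprod.inl_desc_assoc, Category.assoc, ← hm', pullback.condition_assoc]
      exact ht₂.precomp _
    · rwa [coprod.inr_desc_assoc]

omit [FinitaryExtensive C] [HasFiniteLimits C] in
theorem exists_lift_isPullback {D G A P B X : C} {γ : D ⟶ A} {m : A ⟶ X} {β : B ⟶ X}
    {u : G ⟶ D} {v : G ⟶ B} {p : P ⟶ A} {q : P ⟶ B} (hG : IsPullback u v (γ ≫ m) β)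
    (hP : IsPullback p q m β) : ∃ w : G ⟶ P, IsPullback w u p γ ∧ w ≫ q = v :=
  ⟨_, (IsPullback.of_bot' hG hP).flip, hP.lift_snd _ _ _⟩

/-- A congruence diagram is pulled back along a partial map. -/
theorem hasCongruenceDiagram_precomp {W : C} (g : PartialMap W X) {f₁ f₂ : PartialMap X Y}
    (h : HasCongruenceDiagram Z f₁ f₂) : HasCongruenceDiagram Z (g.comp f₁) (g.comp f₂) := by
  obtain ⟨D, D₁, D₂, γ₁, δ₁, γ₂, δ₂, hd₁ : IsDecomposition _ _, hd₂ : IsDecomposition _ _,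
    hι, hm, ht₁, ht₂⟩ := h
  obtain ⟨G, u, v, hG⟩ : ∃ (G : C) (u : G ⟶ D) (v : G ⟶ g.dom),
      IsPullback u v (γ₁ ≫ f₁.ι) g.map :=
    ⟨_, _, _, IsPullback.of_hasPullback _ _⟩
  have hG' := hG
  rw [hι] at hG'
  obtain ⟨w₁, hw₁, hw₁'⟩ :=
    exists_lift_isPullback hG (IsPullback.of_hasPullback g.map f₁.ι).flip
  obtain ⟨w₂, hw₂, hw₂'⟩ :=
    exists_lift_isPullback hG' (IsPullback.of_hasPullback g.map f₂.ι).flip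
  refine ⟨_, _, _, w₁, _, w₂, _, hd₁.of_isPullback hw₁ (IsPullback.of_hasPullback _ δ₁),
    hd₂.of_isPullback hw₂ (IsPullback.of_hasPullback _ δ₂), ?_, ?_, ?_, ?_⟩
  · simp only [reassoc_of% hw₁', reassoc_of% hw₂']
  · simp only [hw₁.w_assoc, hw₂.w_assoc, hm]
  · simp only [pullback.condition_assoc]
    exact ht₁.precomp _
  · simp only [pullback.condition_assoc]
    exact ht₂.precomp _

/-- Composition with `g` replaces the parts of a congruence diagram by the inverse images of the
domain of `g`. The restriction and corestriction of a trivial morphism to such an inverse image is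
trivial because the domain of `g` is complemented. -/
theorem IsStableClass.hasCongruenceDiagram_postcomp (hZ : IsStableClass Z) {V : C}
    {f₁ f₂ : PartialMap X Y} (h : HasCongruenceDiagram Z f₁ f₂) (g : PartialMap Y V) :
    HasCongruenceDiagram Z (f₁.comp g) (f₂.comp g) := by
  obtain ⟨D, D₁, D₂, γ₁, δ₁, γ₂, δ₂, hd₁ : IsDecomposition _ _, hd₂ : IsDecomposition _ _,
    hι, hm, ht₁, ht₂⟩ := h
  obtain ⟨G, u, v, hG⟩ : ∃ (G : C) (u : G ⟶ D) (v : G ⟶ g.dom),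
      IsPullback u v (γ₁ ≫ f₁.map) g.ι :=
    ⟨_, _, _, IsPullback.of_hasPullback _ _⟩
  have hG' := hG
  rw [hm] at hG'
  obtain ⟨w₁, hw₁, hw₁'⟩ := exists_lift_isPullback hG (IsPullback.of_hasPullback f₁.map g.ι)
  obtain ⟨w₂, hw₂, hw₂'⟩ :=
    exists_lift_isPullback hG' (IsPullback.of_hasPullback f₂.map g.ι)
  refine ⟨_, _, _, w₁, _, w₂, _, hd₁.of_isPullback hw₁ (IsPullback.of_hasPullback _ δ₁),
    hd₂.of_isPullback hw₂ (IsPullback.of_hasPullback _ δ₂), ?_, ?_, ?_, ?_⟩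
  · simp only [hw₁.w_assoc, hw₂.w_assoc, hι]
  · simp only [reassoc_of% hw₁', reassoc_of% hw₂']
  · rw [← Category.assoc]
    refine (hZ.isTrivial_of_comp g.isComplemented ?_).postcomp _
    rw [Category.assoc, ← pullback.condition, pullback.condition_assoc]
    exact ht₁.precomp _
  · rw [← Category.assoc]
    refine (hZ.isTrivial_of_comp g.isComplemented ?_).postcomp _
    rw [Category.assoc, ← pullback.condition, pullback.condition_assoc]
    exact ht₂.precomp _

theorem IsStableClass.congruence (hZ : IsStableClass Z) : Congruence (stableRel Z) where
  equivalence :=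
    { refl := by
        rintro ⟨f⟩
        exact (stableRel_homMk_iff f f).2 (hZ.hasCongruenceDiagram_refl f)
      symm := by
        rintro ⟨f⟩ ⟨g⟩ h
        exact (stableRel_homMk_iff g f).2 ((stableRel_homMk_iff f g).1 h).symm
      trans := by
        rintro ⟨f⟩ ⟨g⟩ ⟨h⟩ hfg hgh
        exact (stableRel_homMk_iff f h).2 (hZ.hasCongruenceDiagram_trans
          ((stableRel_homMk_iff f g).1 hfg) ((stableRel_homMk_iff g h).1 hgh)) }
  comp_left := by
    rintro _ _ _ ⟨g⟩ ⟨f₁⟩ ⟨f₂⟩ h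
    exact (stableRel_homMk_iff (g.comp f₁) (g.comp f₂)).2
      (hasCongruenceDiagram_precomp g ((stableRel_homMk_iff f₁ f₂).1 h))
  comp_right := by
    rintro _ _ _ ⟨f₁⟩ ⟨f₂⟩ ⟨g⟩ h
    exact (stableRel_homMk_iff (f₁.comp g) (f₂.comp g)).2
      (hZ.hasCongruenceDiagram_postcomp ((stableRel_homMk_iff f₁ f₂).1 h) g)

end CongruenceDiagram

/-! ### Morphisms of the stable category -/

section Stab

variable {C : Type u} [Category.{v} C] {Z : ObjectProperty C} [FinitaryExtensive C]
  [HasFiniteLimits C] {X Y : C}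

/-- The morphism of the stable category represented by a partial map. -/
noncomputable def stabMk (Z : ObjectProperty C) {X Y : C} (f : PartialMap X Y) :
    (toStab Z).obj X ⟶ (toStab Z).obj Y :=
  (CategoryTheory.Quotient.functor (stableRel Z)).map (Par.homMk (X := ⟨X⟩) (Y := ⟨Y⟩) f)

theorem toStab_obj_surjective (W : Stab Z) : ∃ X : C, (toStab Z).obj X = W :=
  ⟨W.as.as, rfl⟩

theorem stabMk_surjective (φ : (toStab Z).obj X ⟶ (toStab Z).obj Y) :
    ∃ f : PartialMap X Y, stabMk Z f = φ := by
  obtain ⟨⟨f⟩⟩ := φ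
  exact ⟨f, rfl⟩

theorem IsStableClass.stabMk_eq_iff (hZ : IsStableClass Z) (f g : PartialMap X Y) :
    stabMk Z f = stabMk Z g ↔ HasCongruenceDiagram Z f g := by
  have := hZ.congruence
  exact (CategoryTheory.Quotient.functor_map_eq_iff _ _ _).trans
    (stableRel_homMk_iff (X := ⟨X⟩) (Y := ⟨Y⟩) f g)

theorem stabMk_eq_of_equiv {f g : PartialMap X Y} (h : (PartialMap.setoid X Y).r f g) :
    stabMk Z f = stabMk Z g :=
  congrArg (CategoryTheory.Quotient.functor (stableRel Z)).map
    (_root_.Quotient.sound (s := PartialMap.setoid X Y) h :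
      Par.homMk (X := ⟨X⟩) (Y := ⟨Y⟩) f = Par.homMk g)

theorem stabMk_comp {W : C} (f : PartialMap X Y) (g : PartialMap Y W) :
    stabMk Z f ≫ stabMk Z g = stabMk Z (f.comp g) :=
  ((CategoryTheory.Quotient.functor (stableRel Z)).map_comp _ _).symm

theorem stabMk_comp_map {W : C} (f : PartialMap X Y) (k : Y ⟶ W) :
    stabMk Z f ≫ (toStab Z).map k =
      stabMk Z ⟨f.dom, f.ι, f.isComplemented, f.map ≫ k⟩ :=
  (stabMk_comp f (PartialMap.ofHom k)).trans (stabMk_eq_of_equiv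
    (PartialMap.comp_equiv _ _ _ (𝟙 _) f.map (IsPullback.of_horiz_isIso ⟨by simp⟩) (by simp) rfl))

theorem map_comp_stabMk {W D : C} (q : X ⟶ Y) (g : PartialMap Y W) {d : D ⟶ X} {u : D ⟶ g.dom}
    (h : IsPullback d u q g.ι) :
    (toStab Z).map q ≫ stabMk Z g =
      stabMk Z ⟨D, d, g.isComplemented.of_isPullback h, u ≫ g.map⟩ :=
  (stabMk_comp (PartialMap.ofHom q) g).trans (stabMk_eq_of_equiv
    (PartialMap.comp_equiv _ _ _ d u h (by simp) rfl))

theorem IsStableClass.isZero_initial (hZ : IsStableClass Z) : IsZero ((toStab Z).obj (⊥_ C)) where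
  unique_to Y := by
    refine ⟨⟨⟨(toStab Z).map (initial.to Y.as.as)⟩, fun φ => ?_⟩⟩
    obtain ⟨f, rfl⟩ := stabMk_surjective (X := ⊥_ C) (Y := Y.as.as) φ
    have := isIso_initial_to f.ι
    exact (hZ.stabMk_eq_iff f (PartialMap.ofHom _)).2 (hasCongruenceDiagram_of_isTrivial
      (hZ.isTrivial_of_isIso_initial_to _) (isTrivial_of_source hZ.initial _))
  unique_from Y := by
    refine ⟨⟨⟨stabMk Z ⟨⊥_ C, initial.to Y.as.as, (IsDecomposition.initial_id _).isComplemented,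
      𝟙 _⟩⟩, fun φ => ?_⟩⟩
    obtain ⟨f, rfl⟩ := stabMk_surjective (X := Y.as.as) (Y := ⊥_ C) φ
    exact (hZ.stabMk_eq_iff _ _).2 (hasCongruenceDiagram_of_isTrivial
      (isTrivial_of_target hZ.initial _) (isTrivial_of_target hZ.initial _))

theorem IsStableClass.stabMk_eq_zero_iff (hZ : IsStableClass Z) [HasZeroMorphisms (Stab Z)]
    (f : PartialMap X Y) : stabMk Z f = 0 ↔ IsTrivial Z f.map := by
  obtain ⟨n, hn, hn'⟩ : ∃ n : PartialMap X Y, stabMk Z n = 0 ∧ IsTrivial Z n.map := by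
    obtain ⟨v, hv⟩ := stabMk_surjective (0 : (toStab Z).obj X ⟶ (toStab Z).obj (⊥_ C))
    refine ⟨⟨v.dom, v.ι, v.isComplemented, v.map ≫ initial.to Y⟩, ?_,
      (isTrivial_of_target hZ.initial v.map).postcomp _⟩
    rw [← stabMk_comp_map, hv, zero_comp]
  rw [← hn, hZ.stabMk_eq_iff]
  exact ⟨fun h => hZ.isTrivial_of_hasCongruenceDiagram h hn',
    fun h => hasCongruenceDiagram_of_isTrivial h hn'⟩

theorem IsStableClass.map_eq_zero_iff (hZ : IsStableClass Z) [HasZeroMorphisms (Stab Z)]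
    (f : X ⟶ Y) : (toStab Z).map f = 0 ↔ IsTrivial Z f :=
  hZ.stabMk_eq_zero_iff (PartialMap.ofHom f)

end Stab

/-! ### Preservation of kernels -/

section Preservation

theorem isKernelOf_of_existsUnique {B : Type*} [Category B] [HasZeroMorphisms B] {K X Y : B}
    {k : K ⟶ X} {f : X ⟶ Y} (w : k ≫ f = 0)
    (h : ∀ {W : B} (l : W ⟶ X), l ≫ f = 0 → ∃! l' : W ⟶ K, l' ≫ k = l) : IsKernelOf k f := by
  choose d hd hu using fun (W : B) (l : W ⟶ X) (hl : l ≫ f = 0) => h l hl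
  exact ⟨w, ⟨KernelFork.IsLimit.ofι k w (fun {W} l hl => d W l hl) (fun {W} l hl => hd W l hl)
    (fun {W} l hl m hm => hu W l hl m hm)⟩⟩

theorem isCokernelOf_of_existsUnique {B : Type*} [Category B] [HasZeroMorphisms B] {X Y Q : B}
    {q : Y ⟶ Q} {f : X ⟶ Y} (w : f ≫ q = 0)
    (h : ∀ {W : B} (l : Y ⟶ W), f ≫ l = 0 → ∃! l' : Q ⟶ W, q ≫ l' = l) : IsCokernelOf q f := by
  choose d hd hu using fun (W : B) (l : Y ⟶ W) (hl : f ≫ l = 0) => h l hl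
  exact ⟨w, ⟨CokernelCofork.IsColimit.ofπ q w (fun {W} l hl => d W l hl)
    (fun {W} l hl => hd W l hl) (fun {W} l hl m hm => hu W l hl m hm)⟩⟩

variable {C : Type u} [Category.{v} C] {Z : ObjectProperty C} [FinitaryExtensive C]
  [HasFiniteLimits C]

/-- Only the underlying morphism of a partial map is lifted through `k`; its domain stays the same.
Likewise, a congruence diagram for two composites with `k` is one for the partial maps themselves,
as `k` is monic and reflects triviality. -/
theorem IsStableClass.isKernelOf_map (hZ : IsStableClass Z) [HasZeroMorphisms (Stab Z)]
    {K X Y : C} {k : K ⟶ X} {f : X ⟶ Y} (h : IsZKernel Z k f) :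
    IsKernelOf ((toStab Z).map k) ((toStab Z).map f) := by
  have := h.mono
  refine isKernelOf_of_existsUnique ?_ fun {W} φ hφ => ?_
  · rw [← Functor.map_comp, hZ.map_eq_zero_iff]
    exact h.1
  · obtain ⟨W, rfl⟩ := toStab_obj_surjective W
    obtain ⟨l, rfl⟩ := stabMk_surjective φ
    rw [stabMk_comp_map, hZ.stabMk_eq_zero_iff] at hφ
    obtain ⟨s, hs, -⟩ := h.2 l.map hφ
    refine existsUnique_of_exists_of_unique ⟨stabMk Z ⟨l.dom, l.ι, l.isComplemented, s⟩, ?_⟩ ?_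
    · simp only [stabMk_comp_map, hs]
    · intro ψ₁ ψ₂ h₁ h₂
      obtain ⟨l₁, rfl⟩ := stabMk_surjective ψ₁
      obtain ⟨l₂, rfl⟩ := stabMk_surjective ψ₂
      have h₁₂ := h₁.trans h₂.symm
      rw [stabMk_comp_map, stabMk_comp_map, hZ.stabMk_eq_iff] at h₁₂
      obtain ⟨D, D₁, D₂, γ₁, δ₁, γ₂, δ₂, hd₁, hd₂, hι, hm, ht₁, ht₂⟩ := h₁₂
      refine (hZ.stabMk_eq_iff _ _).2 ⟨D, D₁, D₂, γ₁, δ₁, γ₂, δ₂, hd₁, hd₂, hι, ?_, ?_, ?_⟩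
      · simpa [← cancel_mono k] using hm
      · exact h.isTrivial_of_comp (by simpa using ht₁)
      · exact h.isTrivial_of_comp (by simpa using ht₂)

/-! ### Restriction and decomposition of trivial cokernels -/

/-- Complemented subobjects are determined by their inverse images along an epimorphism, because
they are classified by morphisms to `⊤ + ⊤`. -/
theorem exists_iso_of_isPullback_of_epi {X Q E G D : C} {q : X ⟶ Q} [Epi q] {e : E ⟶ Q}
    {g : G ⟶ Q} (he : IsComplemented e) (hg : IsComplemented g) {d : D ⟶ X} {u : D ⟶ E}
    {w : D ⟶ G} (hu : IsPullback d u q e) (hw : IsPullback d w q g) :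
    ∃ i : E ≅ G, i.hom ≫ g = e := by
  obtain ⟨E', e', hE : IsDecomposition e e'⟩ := he
  obtain ⟨G', g', hG : IsDecomposition g g'⟩ := hg
  obtain ⟨c, hc, hc'⟩ := hE.desc (terminal.from E ≫ (coprod.inl : ⊤_ C ⟶ (⊤_ C) ⨿ (⊤_ C)))
    (terminal.from E' ≫ coprod.inr)
  obtain ⟨k, hk, hk'⟩ := hG.desc (terminal.from G ≫ (coprod.inl : ⊤_ C ⟶ (⊤_ C) ⨿ (⊤_ C)))
    (terminal.from G' ≫ coprod.inr)
  have hdE := hE.of_isPullback hu (IsPullback.of_hasPullback q e')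
  have hdG := hG.of_isPullback hw (IsPullback.of_hasPullback q g')
  obtain ⟨r, hr⟩ := hdE.exists_lift_of_isDecomposition hdG
  have hck : c = k := by
    rw [← cancel_epi q]
    refine hdG.hom_ext ?_ ?_
    · rw [reassoc_of% hu.w, hc, reassoc_of% hw.w, hk, ← Category.assoc, ← Category.assoc]
      exact congrArg (· ≫ _) (Subsingleton.elim _ _)
    · calc pullback.fst q g' ≫ q ≫ c
          = (r ≫ pullback.snd q e' ≫ terminal.from E') ≫ coprod.inr := by
            rw [← reassoc_of% hr, pullback.condition_assoc, hc', Category.assoc, Category.assoc]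
        _ = (pullback.snd q g' ≫ terminal.from G') ≫ coprod.inr :=
            congrArg (· ≫ _) (Subsingleton.elim _ _)
        _ = pullback.fst q g' ≫ q ≫ k := by
            rw [pullback.condition_assoc, hk', Category.assoc]
  subst hck
  have hT := IsDecomposition.coprod (⊤_ C) (⊤_ C)
  exact ⟨(hT.isPullback hE hc hc').isoIsPullback _ _ (hT.isPullback hG hk hk'),
    IsPullback.isoIsPullback_hom_fst _ _ _ _⟩

/-- Epimorphisms restrict to complemented subobjects. -/
theorem epi_of_isPullback_isComplemented {X Q E D : C} {q : X ⟶ Q} [Epi q] {e : E ⟶ Q}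
    (he : IsComplemented e) {d : D ⟶ X} {u : D ⟶ E} (hu : IsPullback d u q e) : Epi u := by
  obtain ⟨E', e', hE : IsDecomposition e e'⟩ := he
  refine ⟨fun {W} a b hab => ?_⟩
  obtain ⟨m, hm, hm'⟩ := hE.desc (a ≫ (coprod.inl : W ⟶ W ⨿ E')) coprod.inr
  obtain ⟨n, hn, hn'⟩ := hE.desc (b ≫ (coprod.inl : W ⟶ W ⨿ E')) coprod.inr
  have hmn : m = n := by
    rw [← cancel_epi q]
    refine (hE.of_isPullback hu (IsPullback.of_hasPullback q e')).hom_ext ?_ ?_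
    · rw [reassoc_of% hu.w, reassoc_of% hu.w, hm, hn, reassoc_of% hab]
    · rw [pullback.condition_assoc, pullback.condition_assoc, hm', hn']
  have := (IsDecomposition.coprod W E').isComplemented.mono
  rw [← cancel_mono (coprod.inl : W ⟶ W ⨿ E'), ← hm, ← hn, hmn]

/-- Let `q : X ⟶ Q` be a `Z`-cokernel of `f : A ⟶ X`, and let `l` and `l'` be morphisms on the two
parts of a decomposition `X = D + D'` that become trivial on the corresponding parts of `A`. The
induced morphism `X ⟶ W + W'` then extends along `q`, so that the decomposition of `X` comes from
one of `Q`, and `l` extends to the first part of the latter. -/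
theorem IsZCokernel.exists_isDecomposition (hZ : IsStableClass Z) {A X Q : C} {f : A ⟶ X}
    {q : X ⟶ Q} (h : IsZCokernel Z q f) {D D' A₁ A₂ W W' : C} {d : D ⟶ X} {d' : D' ⟶ X}
    (hd : IsDecomposition d d') {a₁ : A₁ ⟶ A} {r₁ : A₁ ⟶ D} {a₂ : A₂ ⟶ A} {r₂ : A₂ ⟶ D'}
    (ha₁ : IsPullback a₁ r₁ f d) (ha₂ : IsPullback a₂ r₂ f d') {l : D ⟶ W} {l' : D' ⟶ W'}
    (hl : IsTrivial Z (r₁ ≫ l)) (hl' : IsTrivial Z (r₂ ≫ l')) :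
    ∃ (E E' : C) (e : E ⟶ Q) (e' : E' ⟶ Q) (u : D ⟶ E) (u' : D' ⟶ E') (k : E ⟶ W),
      IsDecomposition e e' ∧ IsPullback d u q e ∧ IsPullback d' u' q e' ∧ u ≫ k = l := by
  obtain ⟨m, hm, hm'⟩ := hd.desc (l ≫ (coprod.inl : W ⟶ W ⨿ W')) (l' ≫ coprod.inr)
  have ht : IsTrivial Z (f ≫ m) := by
    refine hZ.isTrivial_of_isDecomposition (hd.of_isPullback ha₁ ha₂) ?_ ?_
    · rw [reassoc_of% ha₁.w, hm, ← Category.assoc]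
      exact hl.postcomp _
    · rw [reassoc_of% ha₂.w, hm', ← Category.assoc]
      exact hl'.postcomp _
  obtain ⟨n, rfl, -⟩ := h.2 m ht
  have hT := IsDecomposition.coprod W W'
  have hp := IsPullback.of_hasPullback n (coprod.inl : W ⟶ W ⨿ W')
  have hp' := IsPullback.of_hasPullback n (coprod.inr : W' ⟶ W ⨿ W')
  exact ⟨_, _, _, _, _, _, _, hT.pullback n, IsPullback.of_bot' (hT.isPullback hd hm hm') hp,
    IsPullback.of_bot' (hT.symm.isPullback hd.symm hm' hm) hp', hp.lift_snd _ _ _⟩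

/-- `Z`-cokernels restrict to complemented subobjects. -/
theorem IsZCokernel.of_isPullback (hZ : IsStableClass Z) {A X Q : C} {f : A ⟶ X}
    {q : X ⟶ Q} (h : IsZCokernel Z q f) {E D A₁ : C} {e : E ⟶ Q} (he : IsComplemented e)
    {d : D ⟶ X} {u : D ⟶ E} (hu : IsPullback d u q e) {a : A₁ ⟶ A} {r : A₁ ⟶ D}
    (ha : IsPullback a r f d) : IsZCokernel Z u r := by
  have := h.epi
  have := epi_of_isPullback_isComplemented he hu
  have he₀ := he
  obtain ⟨E', e', hE : IsDecomposition e e'⟩ := he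
  refine ⟨hZ.isTrivial_of_comp he₀ ?_, fun {W} l hl => ?_⟩
  · rw [Category.assoc, ← hu.w, ← reassoc_of% ha.w]
    exact h.1.precomp _
  · have hd := hE.of_isPullback hu (IsPullback.of_hasPullback q e')
    have hl' : IsTrivial Z (pullback.snd f (pullback.fst q e') ≫ pullback.snd q e') := by
      refine hZ.isTrivial_of_comp hE.symm.isComplemented ?_
      rw [Category.assoc, ← pullback.condition, ← pullback.condition_assoc]
      exact h.1.precomp _
    obtain ⟨G, G', g, g', w, w', k, hG, hw, -, hk⟩ :=
      h.exists_isDecomposition hZ hd ha (IsPullback.of_hasPullback f _) hl hl'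
    obtain ⟨i, hi⟩ := exists_iso_of_isPullback_of_epi he₀ hG.isComplemented hu hw
    have := hG.isComplemented.mono
    have hui : u ≫ i.hom = w := by
      rw [← cancel_mono g, Category.assoc, hi, ← hu.w, hw.w]
    refine ⟨i.hom ≫ k, by simp only [reassoc_of% hui, hk], fun k' hk' => ?_⟩
    rw [← cancel_epi u, hk', reassoc_of% hui, hk]

/-- Let `h : Q ⇀ V` be a partial map, and `q : X ⟶ Q` a `Z`-cokernel. A decomposition of the
domain of `q ≫ h` into two parts, the second of which has trivial restriction, comes from such a
decomposition of the domain of `h`. -/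
theorem IsZCokernel.exists_isDecomposition_dom (hZ : IsStableClass Z) {A X Q V : C} {f : A ⟶ X}
    {q : X ⟶ Q} (hq : IsZCokernel Z q f) (h : PartialMap Q V) {P D D' : C} {d : P ⟶ X}
    {u : P ⟶ h.dom} (hu : IsPullback d u q h.ι) {γ : D ⟶ P} {δ : D' ⟶ P}
    (hd : IsDecomposition γ δ) (ht : IsTrivial Z (δ ≫ u ≫ h.map)) :
    ∃ (G G' : C) (g : G ⟶ h.dom) (g' : G' ⟶ h.dom) (w : D ⟶ G),
      IsDecomposition g g' ∧ IsPullback (γ ≫ d) w q (g ≫ h.ι) ∧ γ ≫ u = w ≫ g ∧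
        IsTrivial Z (g' ≫ h.map) := by
  have hc := hq.of_isPullback hZ h.isComplemented hu (IsPullback.of_hasPullback f d)
  have htr : ∀ {S : C} (s : S ⟶ P), IsTrivial Z (pullback.snd (pullback.snd f d) s ≫ s ≫ u) := by
    intro S s
    rw [← pullback.condition_assoc]
    exact hc.1.precomp _
  obtain ⟨G, G', g, g', w, w', -, hG, hw, hw', -⟩ := hc.exists_isDecomposition hZ hd
    (IsPullback.of_hasPullback _ γ) (IsPullback.of_hasPullback _ δ) (htr γ) (htr δ)
  have hc' := hc.of_isPullback hZ hG.symm.isComplemented hw' (IsPullback.of_hasPullback _ δ)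
  refine ⟨G, G', g, g', w, hG, hw.paste_horiz hu, hw.w, hc'.isTrivial_of_comp ?_⟩
  rwa [← reassoc_of% hw'.w]

/-! ### Preservation of cokernels -/

/-- For existence, a partial map `g : X ⇀ V` vanishing on `A` is completed by `q` on the complement
of its domain to a morphism `X ⟶ V + Q`, which extends along `q`. For uniqueness, the parts of a
congruence diagram over `X` descend to parts of a congruence diagram over `Q`. -/
theorem IsStableClass.isCokernelOf_map (hZ : IsStableClass Z) [HasZeroMorphisms (Stab Z)]
    {A X Q : C} {f : A ⟶ X} {q : X ⟶ Q} (h : IsZCokernel Z q f) :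
    IsCokernelOf ((toStab Z).map q) ((toStab Z).map f) := by
  have := h.epi
  refine isCokernelOf_of_existsUnique ?_ fun {V} φ hφ => ?_
  · rw [← Functor.map_comp, hZ.map_eq_zero_iff]
    exact h.1
  obtain ⟨V, rfl⟩ := toStab_obj_surjective V
  refine existsUnique_of_exists_of_unique ?_ ?_
  · obtain ⟨g, rfl⟩ := stabMk_surjective φ
    obtain ⟨B', β', hB : IsDecomposition g.ι β'⟩ := g.isComplemented
    rw [map_comp_stabMk f g (IsPullback.of_hasPullback f g.ι), hZ.stabMk_eq_zero_iff] at hφ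
    -- Off the domain of `g`, the morphism `q` itself is trivial on `A`.
    have ht : IsTrivial Z (pullback.snd f β' ≫ β' ≫ q) := by
      rw [← pullback.condition_assoc]
      exact h.1.precomp _
    obtain ⟨E, E', e, e', u, u', k, hE, hu, -, hk⟩ := h.exists_isDecomposition hZ hB
      (IsPullback.of_hasPullback f g.ι) (IsPullback.of_hasPullback f β') hφ ht
    refine ⟨stabMk Z ⟨E, e, hE.isComplemented, k⟩, ?_⟩
    rw [map_comp_stabMk q ⟨E, e, hE.isComplemented, k⟩ hu]
    simp only [hk]
  · intro ψ₁ ψ₂ h₁ h₂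
    obtain ⟨l₁, rfl⟩ := stabMk_surjective ψ₁
    obtain ⟨l₂, rfl⟩ := stabMk_surjective ψ₂
    have h₁₂ := h₁.trans h₂.symm
    have hu₁ := IsPullback.of_hasPullback q l₁.ι
    have hu₂ := IsPullback.of_hasPullback q l₂.ι
    rw [map_comp_stabMk q l₁ hu₁, map_comp_stabMk q l₂ hu₂, hZ.stabMk_eq_iff] at h₁₂
    obtain ⟨D, D₁, D₂, γ₁, δ₁, γ₂, δ₂, hd₁, hd₂, hι, hm, ht₁, ht₂⟩ := h₁₂
    dsimp only at γ₁ δ₁ γ₂ δ₂ hd₁ hd₂ hι hm ht₁ ht₂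
    obtain ⟨G₁, G₁', g₁, g₁', w₁, hG₁, hw₁, hγ₁, hg₁⟩ :=
      h.exists_isDecomposition_dom hZ l₁ hu₁ hd₁ ht₁
    obtain ⟨G₂, G₂', g₂, g₂', w₂, hG₂, hw₂, hγ₂, hg₂⟩ :=
      h.exists_isDecomposition_dom hZ l₂ hu₂ hd₂ ht₂
    rw [← hι] at hw₂
    have hc₁ := hG₁.isComplemented.comp l₁.isComplemented
    have hc₂ := hG₂.isComplemented.comp l₂.isComplemented
    have := hc₂.mono
    have := epi_of_isPullback_isComplemented hc₁ hw₁
    obtain ⟨i, hi⟩ := exists_iso_of_isPullback_of_epi hc₁ hc₂ hw₁ hw₂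
    have hwi : w₁ ≫ i.hom = w₂ := by
      rw [← cancel_mono (g₂ ≫ l₂.ι), Category.assoc, hi, ← hw₁.w, hw₂.w]
    refine (hZ.stabMk_eq_iff _ _).2 ⟨G₁, G₁', G₂', g₁, g₁', i.hom ≫ g₂, g₂', hG₁,
      hG₂.iso_comp i, by rw [← hi, Category.assoc], ?_, hg₁, hg₂⟩
    rw [← cancel_epi w₁, ← reassoc_of% hγ₁, hm, reassoc_of% hγ₂, Category.assoc,
      reassoc_of% hwi]

theorem IsStableClass.isShortExactSeq_map (hZ : IsStableClass Z) [HasZeroMorphisms (Stab Z)]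
    {A X B : C} {f : A ⟶ X} {g : X ⟶ B} (h : IsShortZExact Z f g) :
    IsShortExactSeq ((toStab Z).map f) ((toStab Z).map g) :=
  ⟨hZ.isKernelOf_map h.1, hZ.isCokernelOf_map h.2⟩

/-! ### The torsion theory in the stable category -/

namespace IsPretorsionTheory

variable {T F : ObjectProperty C} [HasZeroMorphisms (Stab (T ⊓ F))]

theorem stab_eq_zero (hTF : IsPretorsionTheory T F) (hZ : ClosedUnderBinaryCoproducts (T ⊓ F))
    (hT : ClosedUnderComplementedSubobjects T) {X Y : Stab (T ⊓ F)} (φ : X ⟶ Y)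
    (hX : onStab (T ⊓ F) T X) (hY : onStab (T ⊓ F) F Y) : φ = 0 := by
  obtain ⟨X, rfl⟩ := toStab_obj_surjective X
  obtain ⟨Y, rfl⟩ := toStab_obj_surjective Y
  obtain ⟨f, rfl⟩ := stabMk_surjective φ
  exact ((hTF.isStableClass hZ hT).stabMk_eq_zero_iff f).2
    (hTF.isTrivial_of_torsion_of_torsionFree _ (hT _ f.isComplemented hX) hY)

/-- Both classes are replete in the stable category because each consists of the objects that are
orthogonal there to the other one. -/
theorem isTorsionTheory_stab (hTF : IsPretorsionTheory T F)
    (hZ : ClosedUnderBinaryCoproducts (T ⊓ F)) (hT : ClosedUnderComplementedSubobjects T) :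
    IsTorsionTheory (onStab (T ⊓ F) T) (onStab (T ⊓ F) F) where
  hasZeroObject := ⟨_, (hTF.isStableClass hZ hT).isZero_initial⟩
  torsion_replete := by
    refine ⟨fun {X Y} e hX => ?_⟩
    obtain ⟨Y, rfl⟩ := toStab_obj_surjective Y
    refine hTF.torsion_of_isTrivial (X := Y) fun {W} f hW => ?_
    have := hTF.stab_eq_zero hZ hT (e.hom ≫ (toStab (T ⊓ F)).map f) hX hW
    rw [← (hTF.isStableClass hZ hT).map_eq_zero_iff]
    rwa [← cancel_epi e.hom, comp_zero]
  torsionFree_replete := by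
    refine ⟨fun {X Y} e hX => ?_⟩
    obtain ⟨Y, rfl⟩ := toStab_obj_surjective Y
    refine hTF.torsionFree_of_isTrivial (Y := Y) fun {W} f hW => ?_
    have := hTF.stab_eq_zero hZ hT ((toStab (T ⊓ F)).map f ≫ e.inv) hW hX
    rw [← (hTF.isStableClass hZ hT).map_eq_zero_iff]
    rwa [← cancel_mono e.inv, zero_comp]
  eq_zero φ hX hY := hTF.stab_eq_zero hZ hT φ hX hY
  exists_shortExact X := by
    obtain ⟨X, rfl⟩ := toStab_obj_surjective X
    obtain ⟨A, B, f, g, hA, hB, hfg⟩ := hTF.exists_shortZExact X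
    exact ⟨(toStab _).obj A, (toStab _).obj B, _, _, hA, hB,
      (hTF.isStableClass hZ hT).isShortExactSeq_map hfg⟩

end IsPretorsionTheory

end Preservation

end PretorsionStab

open PretorsionStab in
theorem mainTheorem2 {C : Type u} [Category.{v} C] [HasFiniteLimits C] [FinitaryExtensive C]
    (T F : ObjectProperty C) (hTF : IsPretorsionTheory T F)
    (hZ : ClosedUnderBinaryCoproducts (T ⊓ F))
    (hT : ClosedUnderComplementedSubobjects T) :
    -- the relation defining the stable category is a congruence
    Congruence (stableRel (T ⊓ F)) ∧
    -- the stable category is pointed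
    HasZeroObject (Stab (T ⊓ F)) ∧
    ∃ _ : HasZeroMorphisms (Stab (T ⊓ F)),
      -- preservation properties of `Σ`
      (∀ {K X Y : C} (k : K ⟶ X) (f : X ⟶ Y), IsZKernel (T ⊓ F) k f →
        IsKernelOf ((toStab (T ⊓ F)).map k) ((toStab (T ⊓ F)).map f)) ∧
      (∀ {A X B : C} (f : A ⟶ X) (g : X ⟶ B), IsShortZExact (T ⊓ F) f g →
        IsShortExactSeq ((toStab (T ⊓ F)).map f) ((toStab (T ⊓ F)).map g)) ∧
      (HasZCokernels (T ⊓ F) → ∀ {X Y Q : C} (f : X ⟶ Y) (q : Y ⟶ Q), IsZCokernel (T ⊓ F) q f →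
        IsCokernelOf ((toStab (T ⊓ F)).map q) ((toStab (T ⊓ F)).map f)) ∧
      -- `(T, F)` is a torsion theory in the stable category, and `Σ` is a torsion theory functor
      IsTorsionTheory (onStab (T ⊓ F) T) (onStab (T ⊓ F) F) ∧
      IsTorsionTheoryFunctor T F (onStab (T ⊓ F) T) (onStab (T ⊓ F) F) (toStab (T ⊓ F)) := by
  have hS := hTF.isStableClass hZ hT
  have h₀ : HasZeroObject (Stab (T ⊓ F)) := ⟨_, hS.isZero_initial⟩
  let := HasZeroObject.zeroMorphismsOfZeroObject (C := Stab (T ⊓ F))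
  exact ⟨hS.congruence, h₀, inferInstance, fun _ _ h => hS.isKernelOf_map h,
    fun _ _ h => hS.isShortExactSeq_map h, fun _ _ _ _ _ _ h => hS.isCokernelOf_map h,
    hTF.isTorsionTheory_stab hZ hT,
    { map_torsion := fun _ h => h
      map_torsionFree := fun _ h => h
      map_shortExact := fun _ _ _ _ h => hS.isShortExactSeq_map h }⟩
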